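/- Let $S^1,S^2$ be finite sets (the local states of two sites), let $Q=S^1\cap S^2$, and assume $S^i\setminus Q\neq\emptyset$ for $i=1,2$. The $Q$-sequence of a finite or infinite sequence is its subsequence of elements of $Q$. A finite trajectory is a pair $s=(s^1,s^2)$ of finite sequences, $s^i$ in $S^i$, with the same $Q$-sequence; $\Omega$ is the set of pairs $\omega=(\omega^1,\omega^2)$ of infinite sequences, $\omega^i$ in $S^i$, with the same $Q$-sequence, equipped with the trace of the product $\sigma$-algebra. For a finite trajectory $s$ let $\uparrow s\subseteq\Omega$ be the set of $\omega$ such that $s^i$ is a prefix of $\omega^i$ for $i=1,2$, let $\Phi_s:\Omega\to\uparrow s$, $\omega\mapsto s\cdot\omega$, be the componentwise concatenation, and for $\alpha=(x^1,x^2)\in S^1\times S^2$ let $\gamma_\alpha(s)$ be the pair of last letters of $x^1\cdot s^1$ and $x^2\cdot s^2$. A Markov two-components process (M2CP) is a family $(\mathbf P_\alpha)_{\alpha\in X_0}$ of probability measures on $\Omega$, with $X_0\subseteq S^1\times S^2$, such that for all $\alpha\in X_0$ and all finite trajectories $s$ with $\mathbf P_\alpha(\uparrow s)>0$ one has $\gamma_\alpha(s)\in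 X_0$, and the image of $\mathbf P_\alpha(\,\cdot\mid\uparrow s)$ under $\Phi_s^{-1}$ equals $\mathbf P_{\gamma_\alpha(s)}$. For $\omega\in\Omega$ let $Y=(Y_n)_{n\ge0}$ be the common $Q$-sequence of $\omega^1$ and $\omega^2$, continued by a constant value $*\notin S^1\cup S^2$ if it is finite, and let $Y_{-1}=*$. Cut each $\omega^i$ immediately after each of its elements of $Q$; for $n\ge0$ let $\sigma^i_n$ be the $n$-th block so obtained (blocks being numbered from $0$). Thus $\sigma^i_n$ ends with $Y_n$ if $Y_n\ne *$; if there are exactly $N$ synchronizations, $\sigma^i_N$ is the infinite rest of $\omega^i$, and $\sigma^i_n=*$ for $n>N$. The pair $(\sigma^1_n,\sigma^2_n)$ is the $n$-th elementary trajectory of $\omega$ when $Y_n\neq *$. **Theorem.** Let $(\mathbf P_\alpha)_{\alpha\in X_0}$ be an M2CP. Then the following are equivalent: 1. (Local Independence Property) for every $\alpha\in X_0$, $\omega^1$ and $\omega^2$ are conditionally independent given the $\sigma$-algebra generated by $Y$, with respect to $\mathbf P_\alpha$; 2. for every $n\ge0$ and every $\alpha\in X_0$, $\sigma^1_n$ and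 $\sigma^2_n$ are conditionally independent given $(Y_{n-1},Y_n)$, with respect to $\mathbf P_\alpha$. -/

import Mathlib

open MeasureTheory ProbabilityTheory
open scoped ENNReal

noncomputable section

/-! ### Sequences with marked letters

`p : X → Option A` is the partial identification of a letter of `X` with an element of `A`
(`none` when the letter is not in `A`). All indices start at `0`. -/

section Sequences

variable {X A : Type*}

open Classical in
/-- Number of positions `j < k` at which the sequence `x` is in `A`. -/
def visitCount (p : X → Option A) (x : ℕ → X) (k : ℕ) : ℕ :=
  Nat.count (fun j => (p (x j)).isSome) k

open Classical in
/-- The `A`-sequence induced by the infinite sequence `x`: its `n`-th term is the `n`-th element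
of `A` encountered by `x`, and it is `none` if `x` encounters at most `n` elements of `A`. -/
def inducedSeq (p : X → Option A) (x : ℕ → X) (n : ℕ) : Option A :=
  if h : ∃ k, (p (x k)).isSome ∧ visitCount p x k = n then p (x (Nat.find h)) else none

open Classical in
/-- The `n`-th segment of the infinite sequence `x`: the block of letters that come after the
visit to `A` number `n - 1` (from the beginning if `n = 0`), up to and including the visit
number `n` (without end if there is no such visit). A position `k` is in this block iff exactly
`n` of the earlier positions are in `A`.
The block, a finite or infinite sequence, is given by its letters `0, 1, 2, …`, continued by
`none` after its end. It is never empty if `x` has at least `n` visits to `A`; if `x` has fewer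
visits, the value is the constant sequence `none`. -/
def blockSeq (p : X → Option A) (n : ℕ) (x : ℕ → X) (j : ℕ) : Option X :=
  if h : ∃ k, visitCount p x k = n then
    if visitCount p x (Nat.find h + j) = n then some (x (Nat.find h + j)) else none
  else none

/-- Concatenation of a finite and an infinite sequence. -/
def appendSeq (l : List X) (x : ℕ → X) (k : ℕ) : X := l.getD k (x (k - l.length))

theorem visitCount_succ' (p : X → Option A) (x : ℕ → X) (k : ℕ) :
    visitCount p x (k + 1) =
      visitCount p (fun j => x (j + 1)) k + (if (p (x 0)).isSome then 1 else 0) := by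
  simp only [visitCount]
  rw [Nat.count_succ']

theorem inducedSeq_eq_of (p : X → Option A) (x : ℕ → X) (n k : ℕ)
    (h1 : (p (x k)).isSome) (h2 : visitCount p x k = n) :
    inducedSeq p x n = p (x k) := by
  classical
  have h : ∃ k, (p (x k)).isSome ∧ visitCount p x k = n := ⟨k, h1, h2⟩
  have key : ∀ m, (p (x m)).isSome → visitCount p x m = n → m = k := fun m hm hm' =>
    Nat.count_injective (p := fun j => (p (x j)).isSome) hm h1 (hm'.trans h2.symm)
  have hs := Nat.find_spec h
  rw [inducedSeq, dif_pos h, key _ hs.1 hs.2]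

theorem inducedSeq_eq_some_iff (p : X → Option A) (x : ℕ → X) (n : ℕ) (a : A) :
    inducedSeq p x n = some a ↔ ∃ k, p (x k) = some a ∧ visitCount p x k = n := by
  constructor
  · intro h
    by_cases h' : ∃ k, (p (x k)).isSome ∧ visitCount p x k = n
    · obtain ⟨k, h1, h2⟩ := h'
      rw [inducedSeq_eq_of p x n k h1 h2] at h
      exact ⟨k, h, h2⟩
    · rw [inducedSeq, dif_neg h'] at h
      exact absurd h (by simp)
  · rintro ⟨k, h1, h2⟩
    rw [inducedSeq_eq_of p x n k (by simp [h1]) h2, h1]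

/-- The induced sequence of a concatenation depends only on the induced sequences. -/
theorem inducedSeq_appendSeq (p : X → Option A) (l : List X) (x : ℕ → X) :
    inducedSeq p (appendSeq l x) =
      fun n => if h : n < (l.filterMap p).length then some (l.filterMap p)[n]
        else inducedSeq p x (n - (l.filterMap p).length) := by
  induction l with
  | nil => funext n; simp [show appendSeq ([] : List X) x = x from by funext k; simp [appendSeq]]
  | cons a l ih =>
    have hsh : (fun j => appendSeq (a :: l) x (j + 1)) = appendSeq l x := by
      funext j; simp [appendSeq]
    have h0 : appendSeq (a :: l) x 0 = a := by simp [appendSeq]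
    have hs : ∀ k, appendSeq (a :: l) x (k + 1) = appendSeq l x k := fun k => congrFun hsh k
    have hc : ∀ k, visitCount p (appendSeq (a :: l) x) (k + 1) =
        visitCount p (appendSeq l x) k + (if (p a).isSome then 1 else 0) := by
      intro k; rw [visitCount_succ', hsh, h0]
    have hc0 : visitCount p (appendSeq (a :: l) x) 0 = 0 := by simp [visitCount]
    cases hp : p a with
    | none =>
      have key : inducedSeq p (appendSeq (a :: l) x) = inducedSeq p (appendSeq l x) := by
        funext n
        apply Option.ext
        intro b
        rw [inducedSeq_eq_some_iff, inducedSeq_eq_some_iff]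
        constructor
        · rintro ⟨k, h1, h2⟩
          cases k with
          | zero => rw [h0, hp] at h1; exact absurd h1 (by simp)
          | succ k =>
            rw [hs] at h1
            rw [hc, hp] at h2
            exact ⟨k, h1, by simpa using h2⟩
        · rintro ⟨k, h1, h2⟩
          exact ⟨k + 1, by rw [hs]; exact h1, by rw [hc, hp]; simpa using h2⟩
      rw [key, ih]
      simp [List.filterMap_cons_none hp]
    | some q =>
      funext n
      cases n with
      | zero =>
        rw [inducedSeq_eq_of p _ 0 0 (by rw [h0, hp]; rfl) hc0, h0, hp]
        simp [List.filterMap_cons_some hp]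
      | succ n =>
        have key : inducedSeq p (appendSeq (a :: l) x) (n + 1) =
            inducedSeq p (appendSeq l x) n := by
          apply Option.ext
          intro b
          rw [inducedSeq_eq_some_iff, inducedSeq_eq_some_iff]
          constructor
          · rintro ⟨k, h1, h2⟩
            cases k with
            | zero => rw [hc0] at h2; omega
            | succ k =>
              rw [hs] at h1
              rw [hc, hp] at h2
              exact ⟨k, h1, by simpa using h2⟩
          · rintro ⟨k, h1, h2⟩
            exact ⟨k + 1, by rw [hs]; exact h1, by rw [hc, hp]; simpa using h2⟩
        rw [key, ih]
        simp [List.filterMap_cons_some hp]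

end Sequences

/-! ### Distributed systems and trajectories -/

/-- A distributed system on two sites (the sites are `0` and `1`): two finite sets of local
states, possibly with common elements, such that each site has a state that is private to it. -/
structure DistributedSystem (S : Type*) where
  states : Fin 2 → Finset S
  exists_private : ∀ i, ∃ a ∈ states i, ¬ ∀ j, a ∈ states j

namespace DistributedSystem

variable {S : Type*} (D : DistributedSystem S)

/-- Local states of site `i`. -/
def Loc (i : Fin 2) : Type _ := {a : S // a ∈ D.states i}

/-- Shared states: the elements of `Q = S¹ ∩ S²`. -/
def Shared : Type _ := {a : S // ∀ j, a ∈ D.states j}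

open Classical in
/-- A local state as a shared state, if it is one. -/
def toShared (i : Fin 2) (a : D.Loc i) : Option D.Shared :=
  if h : ∀ j, a.1 ∈ D.states j then some ⟨a.1, h⟩ else none

/-- Global states. -/
def GlobalState : Type _ := ∀ i, D.Loc i

/-- Finite trajectories: pairs of finite local trajectories that induce the same `Q`-sequence. -/
def FinTraj : Type _ :=
  {s : ∀ i, List (D.Loc i) // (s 0).filterMap (D.toShared 0) = (s 1).filterMap (D.toShared 1)}

/-- The space `Ω` of maximal trajectories: pairs of infinite local trajectories that induce the
same `Q`-sequence. -/
def Traj : Type _ :=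
  {ω : ∀ i, ℕ → D.Loc i // inducedSeq (D.toShared 0) (ω 0) = inducedSeq (D.toShared 1) (ω 1)}

/-- The global state `γ_α(s)` reached from `α` after the finite trajectory `s`: the pair of last
states of `αⁱ · sⁱ`. -/
def gamma (α : D.GlobalState) (s : D.FinTraj) : D.GlobalState :=
  fun i => (α i :: s.1 i).getLast (List.cons_ne_nil _ _)

/-- The elementary cylinder `↑s` of base `s`: the maximal trajectories that have `s` as a prefix
on both sites. -/
def cyl (s : D.FinTraj) : Set D.Traj :=
  {ω | ∀ i, ∀ k, ∀ h : k < (s.1 i).length, ω.1 i k = (s.1 i)[k]}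

/-- The concatenation map `Φ_s : ω ↦ s · ω`. -/
def concat (s : D.FinTraj) (ω : D.Traj) : D.Traj :=
  ⟨fun i => appendSeq (s.1 i) (ω.1 i), by
    rw [inducedSeq_appendSeq, inducedSeq_appendSeq]
    simp only [s.2, ω.2]⟩

/-- The sequence `(Y_n)_{n ≥ 0}`: the `Q`-sequence induced by `ω` (by either component), followed
by the constant value `* = none` if it is finite. -/
def syncSeq (ω : D.Traj) : ℕ → Option D.Shared := inducedSeq (D.toShared 0) (ω.1 0)

/-- `Y_{n-1}`, with `Y_{-1} = *`. -/
def prevSync (n : ℕ) (ω : D.Traj) : Option D.Shared :=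
  match n with
  | 0 => none
  | m + 1 => D.syncSeq ω m

/-- The pair `(Y_{n-1}, Y_n)`. -/
def syncPair (n : ℕ) (ω : D.Traj) : Option D.Shared × Option D.Shared :=
  (D.prevSync n ω, D.syncSeq ω n)

/-- The local part `σⁱ_n` of the `n`-th elementary trajectory `σ_n` of `ω = σ_0 · σ_1 ⋯`. After
finitely many, say `N`, synchronizations, `σ_N` is the synchronization free infinite rest of `ω`;
and `σⁱ_n` for `n > N` has the value `*`, which is represented by the constant sequence `none`. -/
def sigma (i : Fin 2) (n : ℕ) (ω : D.Traj) : ℕ → Option (D.Loc i) :=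
  blockSeq (D.toShared i) n (ω.1 i)

/-! ### Measurable structure -/

instance (i : Fin 2) : Finite (D.Loc i) := inferInstanceAs (Finite {a : S // a ∈ D.states i})

instance : Finite D.Shared :=
  Finite.of_injective (fun a : D.Shared => (⟨a.1, a.2 0⟩ : D.Loc 0)) fun _ _ h =>
    Subtype.ext (congrArg (fun c : D.Loc 0 => c.1) h)

instance (i : Fin 2) : MeasurableSpace (D.Loc i) := ⊤
instance (i : Fin 2) : DiscreteMeasurableSpace (D.Loc i) := ⟨fun _ => trivial⟩
instance (i : Fin 2) : MeasurableSpace (Option (D.Loc i)) := ⊤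
instance (i : Fin 2) : DiscreteMeasurableSpace (Option (D.Loc i)) := ⟨fun _ => trivial⟩
instance : MeasurableSpace (Option D.Shared) := ⊤
instance : DiscreteMeasurableSpace (Option D.Shared) := ⟨fun _ => trivial⟩

/-- The σ-algebra `𝔉` on `Ω`: the trace of the product σ-algebra. -/
instance : MeasurableSpace D.Traj :=
  inferInstanceAs (MeasurableSpace {ω : ∀ i, ℕ → D.Loc i //
    inducedSeq (D.toShared 0) (ω 0) = inducedSeq (D.toShared 1) (ω 1)})

theorem measurable_visitCount (i : Fin 2) (k : ℕ) :
    Measurable fun x : ℕ → D.Loc i => visitCount (D.toShared i) x k := by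
  induction k with
  | zero => simp [visitCount]
  | succ k ih =>
    have : (fun x : ℕ → D.Loc i => visitCount (D.toShared i) x (k + 1)) = fun x =>
        visitCount (D.toShared i) x k + (if (D.toShared i (x k)).isSome then 1 else 0) := by
      funext x; simp only [visitCount]; rw [Nat.count_succ]
    rw [this]
    exact ih.add ((measurable_of_finite
      (fun a : D.Loc i => if (D.toShared i a).isSome then 1 else 0)).comp (measurable_pi_apply k))

theorem measurable_inducedSeq (i : Fin 2) :
    Measurable (inducedSeq (D.toShared i) : (ℕ → D.Loc i) → ℕ → Option D.Shared) := by
  refine measurable_pi_lambda _ fun n => ?_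
  have hsome : ∀ q : D.Shared,
      MeasurableSet {x : ℕ → D.Loc i | inducedSeq (D.toShared i) x n = some q} := by
    intro q
    have : {x : ℕ → D.Loc i | inducedSeq (D.toShared i) x n = some q} =
        ⋃ k, ({x | D.toShared i (x k) = some q} ∩ {x | visitCount (D.toShared i) x k = n}) := by
      ext x
      simp [inducedSeq_eq_some_iff]
    rw [this]
    refine MeasurableSet.iUnion fun k => MeasurableSet.inter ?_ ?_
    · have h : MeasurableSet {a : D.Loc i | D.toShared i a = some q} := MeasurableSet.of_discrete
      exact (measurable_pi_apply (X := fun _ : ℕ => D.Loc i) k) h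
    · exact D.measurable_visitCount i k (measurableSet_singleton n)
  refine measurable_to_countable' fun o => ?_
  cases o with
  | some q => exact hsome q
  | none =>
    have : (fun x : ℕ → D.Loc i => inducedSeq (D.toShared i) x n) ⁻¹' {none} =
        (⋃ q, {x : ℕ → D.Loc i | inducedSeq (D.toShared i) x n = some q})ᶜ := by
      ext x
      simp [Option.eq_none_iff_forall_ne_some]
    rw [this]
    exact (MeasurableSet.iUnion hsome).compl

instance : StandardBorelSpace D.Traj := by
  have hm : MeasurableSet {ω : ∀ i, ℕ → D.Loc i |
      inducedSeq (D.toShared 0) (ω 0) = inducedSeq (D.toShared 1) (ω 1)} :=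
    measurableSet_eq_fun ((D.measurable_inducedSeq 0).comp (measurable_pi_apply 0))
      ((D.measurable_inducedSeq 1).comp (measurable_pi_apply 1))
  exact hm.standardBorel

theorem measurable_component (i : Fin 2) : Measurable fun ω : D.Traj => ω.1 i :=
  (measurable_pi_apply i).comp measurable_subtype_coe

theorem measurable_syncSeq : Measurable D.syncSeq :=
  (D.measurable_inducedSeq 0).comp (D.measurable_component 0)

theorem measurable_syncPair (n : ℕ) : Measurable (D.syncPair n) := by
  have hY : ∀ m, Measurable fun ω : D.Traj => D.syncSeq ω m := fun m =>
    (measurable_pi_apply m).comp D.measurable_syncSeq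
  refine Measurable.prodMk ?_ (hY n)
  cases n with
  | zero => exact measurable_const
  | succ m => exact hY m

theorem measurableEmbedding_concat (s : D.FinTraj) : MeasurableEmbedding (D.concat s) := by
  refine Measurable.measurableEmbedding ?_ ?_
  · refine Measurable.subtype_mk (measurable_pi_lambda _ fun i => measurable_pi_lambda _ fun k => ?_)
    by_cases h : k < (s.1 i).length
    · simp [appendSeq, h]
    · simp only [appendSeq, List.getD_eq_default _ _ (not_lt.mp h)]
      exact (measurable_pi_apply (k - (s.1 i).length)).comp (D.measurable_component i)
  · intro ω ω' h
    refine Subtype.ext (funext fun i => funext fun k => ?_)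
    have := congrFun (congrFun (congrArg Subtype.val h) i) ((s.1 i).length + k)
    simpa [concat, appendSeq] using this

/-! ### Markov two-components processes -/

/-- `β` is reachable with respect to the probability measure `μ`, starting from `α`. -/
def Reachable (μ : Measure D.Traj) (α β : D.GlobalState) : Prop :=
  ∃ s : D.FinTraj, 0 < μ (D.cyl s) ∧ β = D.gamma α s

/-- The probabilistic future of `s` with respect to `μ`: the image of the conditional probability
`μ( · | ↑s)` under `Φ_s⁻¹ : ↑s → Ω`. -/
def future (μ : Measure D.Traj) (s : D.FinTraj) : Measure D.Traj :=
  (μ[|D.cyl s]).comap (D.concat s)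

/-- A probabilistic two-components process: a family of probability measures on `Ω` indexed by a
set `X₀` of global states that is closed under reachability. -/
structure TwoCompFamily where
  X₀ : Set D.GlobalState
  P : X₀ → Measure D.Traj
  isProbabilityMeasure : ∀ α, IsProbabilityMeasure (P α)
  mem_of_reachable : ∀ (α : X₀) (β : D.GlobalState), D.Reachable (P α) α β → β ∈ X₀

namespace TwoCompFamily

variable {D} (F : D.TwoCompFamily)

instance (α : F.X₀) : IsProbabilityMeasure (F.P α) := F.isProbabilityMeasure α

/-- The Markov property: `(P_α)_s = P_{γ(s)}` whenever `P_α(↑s) > 0`. -/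
def IsMarkov : Prop :=
  ∀ (α : F.X₀) (s : D.FinTraj) (h : 0 < F.P α (D.cyl s)),
    D.future (F.P α) s = F.P ⟨D.gamma α s, F.mem_of_reachable α _ ⟨s, h, rfl⟩⟩

/-- The local independence property: for all `α`, the two components `ω¹` and `ω²` are
independent conditionally on `Y` with respect to `P_α`. -/
def LocalIndependence : Prop :=
  ∀ α : F.X₀, CondIndepFun (MeasurableSpace.comap D.syncSeq inferInstance)
    D.measurable_syncSeq.comap_le
    (fun ω : D.Traj => ω.1 0) (fun ω : D.Traj => ω.1 1) (F.P α)

end TwoCompFamily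

end DistributedSystem

end

/-! Both conditions are equivalent to a third one, `FirstStepIndep` for every `P_α`: the first
blocks are conditionally independent given `Y_0`. The link is the Markov property at the first
synchronization. Whatever private words precede it, a synchronization at `q` leaves the global state
`(q, q)`; hence, given `Y_0 = q`, the future has law `P_(q,q)` and is independent of the first
blocks (`restrict_cyl_elemTraj`).

Condition 2 for `n = 0` is the third condition, since `Y_{-1}` is constant. Conversely, the restart
at `(q, q)` carries the first step to every later step (`measure_sigma_succ`).

Under local independence, the conditional probability of an event of `σ²_0` given `ω¹` is some
`v(Y)`; averaging `v` over the future of `Y` under `P_(q,q)` leaves a function of `Y_0`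
(`firstStepIndep_of_localIndependence`).

For the converse, `condProbOfSync_of_forall_lt` shows that `P(ω² ∈ V | ω¹)` is a function of `Y`
when `V` depends on `k` letters, by induction on `k`. On `Y_0 = q` it is a sum over the first block
of `ω²`: the probability of the block given `q`, times the conditional probability under `P_(q,q)`
of what remains. Blocks ending in a synchronization are nonempty, so fewer letters remain. On `Y_0 =
*` the first blocks are the whole components. -/

/-! ### Conditional independence through explicit conditional probabilities -/

section CondIndep

section Fiber

variable {Ω ζ : Type*} [MeasurableSpace Ω] [MeasurableSpace ζ] [Countable ζ]
  [MeasurableSingletonClass ζ] {μ : Measure Ω} {Z : Ω → ζ}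

theorem measure_eq_setLIntegral_of_fiber (hZ : Measurable Z) {E G : Set Ω}
    (hE : MeasurableSet E) (hG : MeasurableSet G) {f : Ω → ℝ≥0∞}
    (h : ∀ z, μ (E ∩ Z ⁻¹' {z}) = ∫⁻ ω in G ∩ Z ⁻¹' {z}, f ω ∂μ) :
    μ E = ∫⁻ ω in G, f ω ∂μ := by
  have hm : ∀ z, MeasurableSet (Z ⁻¹' {z}) := fun z => hZ (measurableSet_singleton _)
  have hd : ∀ E : Set Ω, Pairwise (Function.onFun Disjoint fun z => E ∩ Z ⁻¹' {z}) :=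
    fun E z w hzw => ((Set.disjoint_singleton.2 hzw).preimage Z).mono Set.inter_subset_right
      Set.inter_subset_right
  have hU : ∀ E : Set Ω, E = ⋃ z, E ∩ Z ⁻¹' {z} := fun E => by ext; simp
  rw [hU E, hU G, measure_iUnion (hd E) fun z => hE.inter (hm z),
    lintegral_iUnion (fun z => hG.inter (hm z)) (hd G)]
  exact tsum_congr h

theorem measure_inter_inter_eq_lintegral {E₁ E₂ : Set Ω} (hE₁ : MeasurableSet E₁)
    (hE₂ : MeasurableSet E₂) (hZ : Measurable Z) {v : ζ → ℝ≥0∞}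
    (h : ∀ z, μ (E₁ ∩ E₂ ∩ Z ⁻¹' {z}) = v z * μ (E₁ ∩ Z ⁻¹' {z})) {C : Set ζ}
    (hC : MeasurableSet C) :
    μ (E₁ ∩ E₂ ∩ Z ⁻¹' C) = ∫⁻ ω in E₁ ∩ Z ⁻¹' C, v (Z ω) ∂μ := by
  refine measure_eq_setLIntegral_of_fiber hZ ((hE₁.inter hE₂).inter (hZ hC))
    (hE₁.inter (hZ hC)) fun z => ?_
  rw [Set.inter_assoc _ (Z ⁻¹' C), Set.inter_assoc _ (Z ⁻¹' C), ← Set.preimage_inter]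
  by_cases hz : z ∈ C
  · rw [Set.inter_eq_right.2 (Set.singleton_subset_iff.2 hz), h,
      setLIntegral_congr_fun (g := fun _ => v z) (hE₁.inter (hZ (measurableSet_singleton z))),
      setLIntegral_const]
    rintro ω ⟨-, hω⟩
    exact congrArg v hω
  · rw [Set.inter_singleton_eq_empty.2 hz]
    simp

end Fiber

variable {Ω : Type*} {m mΩ : MeasurableSpace Ω} [StandardBorelSpace Ω] {μ : Measure Ω}
  [IsFiniteMeasure μ]

/-- The composition product of `μ.trim hm` with the kernel is the law of `ω ↦ (ω, ω)`; integrate `g`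
of the first coordinate times the indicator of `E` at the second. -/
theorem lintegral_mul_condExpKernel (hm : m ≤ mΩ) {E : Set Ω} (hE : MeasurableSet E)
    {g : Ω → ℝ≥0∞} (hg : Measurable[m] g) :
    ∫⁻ ω, g ω * condExpKernel μ m ω E ∂μ.trim hm = ∫⁻ ω in E, g ω ∂μ := by
  have hF : Measurable[m.prod mΩ] fun p : Ω × Ω => g p.1 * E.indicator 1 p.2 :=
    (hg.comp (@measurable_fst _ _ m mΩ)).mul
      ((measurable_one.indicator hE).comp (@measurable_snd _ _ m mΩ))
  have h1 := Measure.lintegral_compProd (μ := μ.trim hm) (κ := condExpKernel μ m) hF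
  have hd : @Measurable Ω (Ω × Ω) mΩ (m.prod mΩ) Function.diag :=
    @Measurable.prodMk _ mΩ _ _ m mΩ _ _ (measurable_id'' hm) measurable_id
  rw [compProd_trim_condExpKernel, @lintegral_map _ _ mΩ (m.prod mΩ) μ _ _ hF hd] at h1
  have h2 : ∀ ω, ∫⁻ b, g ω * E.indicator 1 b ∂condExpKernel μ m ω
      = g ω * condExpKernel μ m ω E := fun ω => by
    rw [lintegral_const_mul _ (measurable_one.indicator hE), lintegral_indicator_one hE]
  simp only [h2] at h1
  rw [← h1, ← lintegral_indicator hE]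
  refine lintegral_congr fun ω => ?_
  by_cases h : ω ∈ E <;> simp [Function.diag, h]

theorem setLIntegral_mul_condExpKernel (hm : m ≤ mΩ) {E C : Set Ω} (hE : MeasurableSet E)
    (hC : MeasurableSet[m] C) {g : Ω → ℝ≥0∞} (hg : Measurable[m] g) :
    ∫⁻ ω in C, g ω * condExpKernel μ m ω E ∂μ.trim hm = ∫⁻ ω in E ∩ C, g ω ∂μ := by
  rw [← lintegral_indicator hC, Set.inter_comm, ← setLIntegral_indicator (hm _ hC),
    ← lintegral_mul_condExpKernel hm hE (hg.indicator hC)]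
  refine lintegral_congr fun ω => ?_
  by_cases h : ω ∈ C <;> simp [h]

theorem setLIntegral_condExpKernel_trim (hm : m ≤ mΩ) {E C : Set Ω} (hE : MeasurableSet E)
    (hC : MeasurableSet[m] C) :
    ∫⁻ ω in C, condExpKernel μ m ω E ∂μ.trim hm = μ (E ∩ C) := by
  simpa using setLIntegral_mul_condExpKernel (μ := μ) hm hE hC (measurable_const (a := 1))

/-- By uniqueness of `m`-measurable densities, `h₂` makes `v` a version of `P(E₂ | m)` and `h₁₂`
makes `v · P(E₁ | m)` a version of `P(E₁ ∩ E₂ | m)`. -/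
theorem condExpKernel_inter_ae_eq (hm : m ≤ mΩ) {E₁ E₂ : Set Ω} (hE₁ : MeasurableSet E₁)
    (hE₂ : MeasurableSet E₂) {v : Ω → ℝ≥0∞} (hv : Measurable[m] v)
    (h₂ : ∀ C, MeasurableSet[m] C → μ (E₂ ∩ C) = ∫⁻ ω in C, v ω ∂μ)
    (h₁₂ : ∀ C, MeasurableSet[m] C → μ (E₁ ∩ E₂ ∩ C) = ∫⁻ ω in E₁ ∩ C, v ω ∂μ) :
    ∀ᵐ ω ∂μ.trim hm, condExpKernel μ m ω (E₁ ∩ E₂)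
      = condExpKernel μ m ω E₁ * condExpKernel μ m ω E₂ := by
  have e₂ : (fun ω => condExpKernel μ m ω E₂) =ᵐ[μ.trim hm] v := by
    refine ae_eq_of_forall_setLIntegral_eq_of_sigmaFinite (measurable_condExpKernel hE₂) hv
      fun C hC _ => ?_
    rw [setLIntegral_condExpKernel_trim hm hE₂ hC, h₂ C hC, setLIntegral_trim hm hv hC]
  have e₁₂ : (fun ω => condExpKernel μ m ω (E₁ ∩ E₂)) =ᵐ[μ.trim hm]
      fun ω => v ω * condExpKernel μ m ω E₁ := by
    refine ae_eq_of_forall_setLIntegral_eq_of_sigmaFinite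
      (measurable_condExpKernel (hE₁.inter hE₂)) (hv.mul (measurable_condExpKernel hE₁))
      fun C hC _ => ?_
    rw [setLIntegral_condExpKernel_trim hm (hE₁.inter hE₂) hC, h₁₂ C hC,
      setLIntegral_mul_condExpKernel hm hE₁ hC hv]
  filter_upwards [e₂, e₁₂] with ω h h'
  rw [h', h, mul_comm]

variable {β γ ζ : Type*} [MeasurableSpace β] [MeasurableSpace γ] [MeasurableSpace ζ]
  {f : Ω → β} {g : Ω → γ} {Z : Ω → ζ}

/-- Two variables `f` and `g` are conditionally independent given `Z` as soon as, for all sets `B`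
in a generating π-system, the conditional probability of `g ∈ B` given `f` and `Z` is a function
of `Z`. -/
theorem condIndepFun_of_exists_lintegral (hf : Measurable f) (hg : Measurable g)
    (hZ : Measurable Z) {p : Set (Set γ)} (hp : IsPiSystem p)
    (hgen : ‹MeasurableSpace γ› = MeasurableSpace.generateFrom p)
    (h : ∀ B ∈ p, ∃ v : ζ → ℝ≥0∞, Measurable v ∧ ∀ A C, MeasurableSet A → MeasurableSet C →
      μ (f ⁻¹' A ∩ g ⁻¹' B ∩ Z ⁻¹' C) = ∫⁻ ω in f ⁻¹' A ∩ Z ⁻¹' C, v (Z ω) ∂μ) :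
    CondIndepFun (MeasurableSpace.comap Z inferInstance) hZ.comap_le f g μ := by
  rw [condIndepFun_iff_condIndep]
  refine CondIndepSets.condIndep (p1 := {s | ∃ A, MeasurableSet A ∧ f ⁻¹' A = s})
    (p2 := {s | ∃ B ∈ p, g ⁻¹' B = s}) hf.comap_le hg.comap_le
    (@MeasurableSpace.isPiSystem_measurableSet _ (MeasurableSpace.comap f inferInstance)) (hp.comap g)
    (@MeasurableSpace.generateFrom_measurableSet _ (MeasurableSpace.comap f inferInstance)).symm
    ?_ ?_
  · conv_lhs => rw [hgen]
    rw [MeasurableSpace.comap_generateFrom]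
    rfl
  · rintro _ _ ⟨A, hA, rfl⟩ ⟨B, hB, rfl⟩
    obtain ⟨v, hv, hvE⟩ := h B hB
    have hBm : MeasurableSet B := by
      rw [hgen]; exact MeasurableSpace.measurableSet_generateFrom hB
    refine condExpKernel_inter_ae_eq hZ.comap_le (hf hA) (hg hBm)
      (hv.comp (comap_measurable Z)) ?_ ?_
    · rintro _ ⟨C, hC, rfl⟩
      -- Taking `A = univ` shows that `v ∘ Z` is the conditional probability of `g ∈ B` given `Z`
      -- alone.
      simpa using hvE Set.univ C MeasurableSet.univ hC
    · rintro _ ⟨C, hC, rfl⟩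
      exact hvE A C hA hC

/-- Here `v` comes from factoring the conditional probability of `g ∈ B`, measurable with respect to
`σ(Z)`, through `Z`. -/
theorem exists_lintegral_of_condIndepFun (hf : Measurable f) (hg : Measurable g)
    (hZ : Measurable Z)
    (h : CondIndepFun (MeasurableSpace.comap Z inferInstance) hZ.comap_le f g μ)
    {B : Set γ} (hB : MeasurableSet B) :
    ∃ v : ζ → ℝ≥0∞, Measurable v ∧ ∀ A C, MeasurableSet A → MeasurableSet C →
      μ (f ⁻¹' A ∩ g ⁻¹' B ∩ Z ⁻¹' C) = ∫⁻ ω in f ⁻¹' A ∩ Z ⁻¹' C, v (Z ω) ∂μ := by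
  have hm := hZ.comap_le
  obtain ⟨v, hv, hvE⟩ := (measurable_condExpKernel (μ := μ)
    (m := MeasurableSpace.comap Z inferInstance) (hg hB)).exists_eq_measurable_comp
  refine ⟨v, hv, fun A C hA hC => ?_⟩
  have hC' : MeasurableSet[MeasurableSpace.comap Z inferInstance] (Z ⁻¹' C) := ⟨C, hC, rfl⟩
  rw [condIndepFun_iff_condIndep] at h
  have h' := h (f ⁻¹' A) (g ⁻¹' B) ⟨A, hA, rfl⟩ ⟨B, hB, rfl⟩
  rw [← setLIntegral_condExpKernel_trim hm ((hf hA).inter (hg hB)) hC',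
    setLIntegral_congr_fun_ae hC' (h'.mono fun ω hω _ => hω)]
  have hvc : Measurable[MeasurableSpace.comap Z inferInstance] fun ω => v (Z ω) :=
    hv.comp (comap_measurable Z)
  rw [← setLIntegral_mul_condExpKernel hm (hf hA) hC' hvc]
  refine lintegral_congr fun ω => ?_
  rw [mul_comm, congrFun hvE ω]
  rfl

end CondIndep

/-! ### Decomposition of a sequence at its first marked letter -/

section FirstVisit

variable {X A : Type*} {p : X → Option A} {x : ℕ → X} {l : List X} {b : X} {q : A}

theorem appendSeq_add_length (l : List X) (x : ℕ → X) (k : ℕ) :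
    appendSeq l x (l.length + k) = x k := by
  simp [appendSeq]

theorem appendSeq_of_lt (l : List X) (x : ℕ → X) {k : ℕ} (h : k < l.length) :
    appendSeq l x k = l[k] := by
  simp [appendSeq, h]

theorem visitCount_eq_zero {k : ℕ} (h : ∀ j < k, p (x j) = none) : visitCount p x k = 0 := by
  classical
  rw [visitCount, Nat.count_iff_forall_not]
  intro j hj
  simp [h j hj]

theorem visitCount_succ_eq (k : ℕ) :
    visitCount p x (k + 1) = visitCount p x k + if (p (x k)).isSome then 1 else 0 := by
  classical
  simp only [visitCount]
  rw [Nat.count_succ]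

theorem appendSeq_concat_none (hl : ∀ a ∈ l, p a = none) {j : ℕ} (hj : j < l.length) :
    p (appendSeq (l ++ [b]) x j) = none := by
  rw [appendSeq_of_lt _ _ (by simp; omega), List.getElem_append_left hj]
  exact hl _ (List.getElem_mem _)

theorem appendSeq_concat_length : appendSeq (l ++ [b]) x l.length = b := by
  rw [appendSeq_of_lt _ _ (by simp)]
  simp

theorem visitCount_appendSeq_of_le (hl : ∀ a ∈ l, p a = none) {k : ℕ} (hk : k ≤ l.length) :
    visitCount p (appendSeq (l ++ [b]) x) k = 0 :=
  visitCount_eq_zero fun _ hj => appendSeq_concat_none hl (hj.trans_le hk)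

theorem visitCount_appendSeq_add (hl : ∀ a ∈ l, p a = none) (hb : p b = some q) (k : ℕ) :
    visitCount p (appendSeq (l ++ [b]) x) ((l ++ [b]).length + k) = visitCount p x k + 1 := by
  induction k with
  | zero =>
    rw [Nat.add_zero, List.length_append, List.length_singleton, visitCount_succ_eq,
      visitCount_appendSeq_of_le hl le_rfl, appendSeq_concat_length, hb]
    simp [visitCount]
  | succ k ih =>
    rw [← Nat.add_assoc, visitCount_succ_eq, ih, visitCount_succ_eq, appendSeq_add_length]
    omega

theorem blockSeq_eq_of {n k : ℕ} (hk : visitCount p x k = n)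
    (hlt : ∀ j < k, visitCount p x j ≠ n) (j : ℕ) :
    blockSeq p n x j = if visitCount p x (k + j) = n then some (x (k + j)) else none := by
  classical
  have h : ∃ k, visitCount p x k = n := ⟨k, hk⟩
  have hf : Nat.find h = k := (Nat.find_eq_iff h).2 ⟨hk, hlt⟩
  rw [blockSeq, dif_pos h, hf]

theorem blockSeq_eq_none {n : ℕ} (h : ∀ k, visitCount p x k ≠ n) (j : ℕ) :
    blockSeq p n x j = none := by
  rw [blockSeq, dif_neg (by simpa using h)]

theorem blockSeq_zero_apply (j : ℕ) :
    blockSeq p 0 x j = if visitCount p x j = 0 then some (x j) else none := by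
  rw [blockSeq_eq_of (k := 0) (by simp [visitCount]) (by simp), Nat.zero_add]

theorem blockSeq_zero_appendSeq (hl : ∀ a ∈ l, p a = none) (hb : p b = some q) (x : ℕ → X) :
    blockSeq p 0 (appendSeq (l ++ [b]) x) = fun j => (l ++ [b])[j]? := by
  funext j
  rw [blockSeq_zero_apply]
  by_cases hj : j < (l ++ [b]).length
  · have hj' : j ≤ l.length := by simp at hj; omega
    rw [if_pos (visitCount_appendSeq_of_le hl hj'), appendSeq_of_lt _ _ hj,
      List.getElem?_eq_getElem hj]
  · rw [List.getElem?_eq_none (not_lt.1 hj), if_neg]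
    obtain ⟨k, rfl⟩ := Nat.exists_eq_add_of_le (not_lt.1 hj)
    rw [visitCount_appendSeq_add hl hb]
    omega

/-- The prefix contains exactly one visit, at its last letter, so it is block `0` and all later
blocks are renumbered by one. -/
theorem blockSeq_succ_appendSeq (hl : ∀ a ∈ l, p a = none) (hb : p b = some q) (n : ℕ)
    (x : ℕ → X) : blockSeq p (n + 1) (appendSeq (l ++ [b]) x) = blockSeq p n x := by
  classical
  -- All positions of the prefix have count `0`, so the search for count `n + 1` starts after it.
  have hlow : ∀ j < (l ++ [b]).length, visitCount p (appendSeq (l ++ [b]) x) j ≠ n + 1 :=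
    fun j hj => by
      rw [visitCount_appendSeq_of_le hl (by simp at hj; omega)]
      omega
  funext j
  by_cases h : ∃ k, visitCount p x k = n
  · have hs := Nat.find_spec h
    have hm := fun j (hj : j < Nat.find h) => Nat.find_min h hj
    rw [blockSeq_eq_of hs hm, blockSeq_eq_of (k := (l ++ [b]).length + Nat.find h)
      (by rw [visitCount_appendSeq_add hl hb, hs])]
    · rw [Nat.add_assoc, visitCount_appendSeq_add hl hb, appendSeq_add_length]
      simp only [Nat.add_right_cancel_iff]
    · intro i hi
      by_cases hi' : i < (l ++ [b]).length
      · exact hlow i hi'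
      · obtain ⟨k, rfl⟩ := Nat.exists_eq_add_of_le (not_lt.1 hi')
        rw [visitCount_appendSeq_add hl hb]
        exact fun e => hm k (by omega) (by omega)
  · rw [not_exists] at h
    rw [blockSeq_eq_none h, blockSeq_eq_none]
    intro i
    by_cases hi' : i < (l ++ [b]).length
    · exact hlow i hi'
    · obtain ⟨k, rfl⟩ := Nat.exists_eq_add_of_le (not_lt.1 hi')
      rw [visitCount_appendSeq_add hl hb]
      exact fun e => h k (by omega)

theorem filterMap_eq_singleton (hl : ∀ a ∈ l, p a = none) (hb : p b = some q) :
    (l ++ [b]).filterMap p = [q] := by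
  rw [List.filterMap_append, List.filterMap_eq_nil_iff.2 hl]
  simp [hb]

theorem inducedSeq_zero_appendSeq (hl : ∀ a ∈ l, p a = none) (hb : p b = some q) (x : ℕ → X) :
    inducedSeq p (appendSeq (l ++ [b]) x) 0 = some q := by
  simp [inducedSeq_appendSeq, filterMap_eq_singleton hl hb]

theorem inducedSeq_succ_appendSeq (hl : ∀ a ∈ l, p a = none) (hb : p b = some q) (x : ℕ → X)
    (n : ℕ) : inducedSeq p (appendSeq (l ++ [b]) x) (n + 1) = inducedSeq p x n := by
  rw [inducedSeq_appendSeq, filterMap_eq_singleton hl hb]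
  simp

theorem inducedSeq_zero_eq_none_iff : inducedSeq p x 0 = none ↔ ∀ k, p (x k) = none := by
  classical
  constructor
  · intro h k
    induction k using Nat.strong_induction_on with
    | _ k ih =>
      by_contra hk
      have hk' := Option.isSome_iff_ne_none.2 hk
      rw [inducedSeq_eq_of p x 0 k hk' (visitCount_eq_zero ih)] at h
      exact hk h
  · intro h
    rw [Option.eq_none_iff_forall_ne_some]
    intro q hq
    obtain ⟨k, hk, -⟩ := (inducedSeq_eq_some_iff p x 0 q).1 hq
    rw [h k] at hk
    cases hk

theorem exists_appendSeq_of_inducedSeq_zero (h : inducedSeq p x 0 = some q) :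
    ∃ l b y, (∀ a ∈ l, p a = none) ∧ p b = some q ∧ x = appendSeq (l ++ [b]) y := by
  classical
  obtain ⟨k, hk, hc⟩ := (inducedSeq_eq_some_iff p x 0 q).1 h
  refine ⟨(List.range k).map x, x k, fun j => x (k + 1 + j), ?_, hk, ?_⟩
  · intro a ha
    obtain ⟨j, hj, rfl⟩ := List.mem_map.1 ha
    rw [visitCount, Nat.count_iff_forall_not] at hc
    simpa using hc _ (List.mem_range.1 hj)
  · funext j
    rcases lt_trichotomy j k with hj | rfl | hj
    · rw [appendSeq_of_lt _ _ (by simp; omega), List.getElem_append_left (by simpa)]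
      simp
    · rw [appendSeq_of_lt _ _ (by simp)]
      simp
    · obtain ⟨i, rfl⟩ := Nat.exists_eq_add_of_lt hj
      have := appendSeq_add_length ((List.range k).map x ++ [x k]) (fun j => x (k + 1 + j)) i
      simp only [List.length_append, List.length_map, List.length_range,
        List.length_singleton] at this
      rw [show k + i + 1 = k + 1 + i by omega, this]

theorem blockSeq_zero_of_inducedSeq_zero (h : inducedSeq p x 0 = none) (j : ℕ) :
    blockSeq p 0 x j = some (x j) := by
  rw [inducedSeq_zero_eq_none_iff] at h
  rw [blockSeq_zero_apply, if_pos (visitCount_eq_zero fun j _ => h j)]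

/-- The count rises by one at each visit only, so reaching `n + 1` requires visit number `n`. -/
theorem blockSeq_succ_of_inducedSeq_eq_none {n : ℕ} (h : inducedSeq p x n = none) (j : ℕ) :
    blockSeq p (n + 1) x j = none := by
  classical
  refine blockSeq_eq_none (fun k hk => ?_) j
  induction k with
  | zero => simp [visitCount] at hk
  | succ k ih =>
    rw [visitCount_succ_eq] at hk
    by_cases hs : (p (x k)).isSome
    · rw [if_pos hs] at hk
      rw [inducedSeq_eq_of p x n k hs (by omega)] at h
      simp [h] at hs
    · rw [if_neg hs] at hk
      exact ih hk

theorem inducedSeq_eq_none_of_zero (h : inducedSeq p x 0 = none) (n : ℕ) :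
    inducedSeq p x n = none := by
  rw [inducedSeq_zero_eq_none_iff] at h
  rw [Option.eq_none_iff_forall_ne_some]
  intro q hq
  obtain ⟨k, hk, -⟩ := (inducedSeq_eq_some_iff p x n q).1 hq
  rw [h k] at hk
  cases hk

end FirstVisit

noncomputable section

namespace DistributedSystem

variable {S : Type*} (D : DistributedSystem S)

/-! ### The first synchronization -/

/-- A shared state as a local state of site `i`. -/
def ofShared (i : Fin 2) (q : D.Shared) : D.Loc i := ⟨q.1, q.2 i⟩

/-- The global state `(q, q)`. -/
def diag (q : D.Shared) : D.GlobalState := fun i => D.ofShared i q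

/-- Finite local trajectories without shared states. -/
def PrivateWord (i : Fin 2) : Type _ := {w : List (D.Loc i) // ∀ a ∈ w, D.toShared i a = none}

instance (i : Fin 2) : Countable (D.PrivateWord i) :=
  inferInstanceAs (Countable {w : List (D.Loc i) // ∀ a ∈ w, D.toShared i a = none})

theorem toShared_ofShared (i : Fin 2) (q : D.Shared) :
    D.toShared i (D.ofShared i q) = some q := dif_pos q.2

theorem eq_ofShared {i : Fin 2} {a : D.Loc i} {q : D.Shared} (h : D.toShared i a = some q) :
    a = D.ofShared i q := by
  unfold toShared at h
  split_ifs at h with h'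
  cases h
  rfl

variable {D}

theorem inducedSeq_component (i : Fin 2) (ω : D.Traj) :
    inducedSeq (D.toShared i) (ω.1 i) = D.syncSeq ω := by
  fin_cases i
  · rfl
  · exact ω.2.symm

/-! ### Measurability of blocks, and cylinders as ranges of concatenation maps. -/

theorem measurable_blockSeq (i : Fin 2) (n : ℕ) :
    Measurable fun x : ℕ → D.Loc i => blockSeq (D.toShared i) n x := by
  classical
  have hc := D.measurable_visitCount i
  have hx : ∀ k, Measurable fun x : ℕ → D.Loc i => x k := fun k => measurable_pi_apply k
  refine measurable_pi_lambda _ fun j => measurable_to_countable' fun o => ?_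
  have key : ∀ a, MeasurableSet {x : ℕ → D.Loc i | blockSeq (D.toShared i) n x j = some a} := fun a => by
    have : {x : ℕ → D.Loc i | blockSeq (D.toShared i) n x j = some a} =
        ⋃ k, (⋂ l ∈ Finset.range k, {x : ℕ → D.Loc i | visitCount (D.toShared i) x l = n}ᶜ) ∩
          ({x : ℕ → D.Loc i | visitCount (D.toShared i) x k = n} ∩
          ({x : ℕ → D.Loc i | visitCount (D.toShared i) x (k + j) = n} ∩
            {x : ℕ → D.Loc i | x (k + j) = a})) := by
      ext x
      simp only [Set.mem_ofPred_eq, Set.mem_iUnion, Set.mem_inter_iff, Set.mem_iInter,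
        Finset.mem_range, Set.mem_compl_iff]
      constructor
      · intro h
        by_cases h' : ∃ k, visitCount (D.toShared i) x k = n
        · rw [blockSeq_eq_of (Nat.find_spec h') (fun l hl => Nat.find_min h' hl)] at h
          split_ifs at h with h''
          exact ⟨_, fun l hl => Nat.find_min h' hl, Nat.find_spec h', h'', by simpa using h⟩
        · rw [blockSeq_eq_none (by simpa using h')] at h
          cases h
      · rintro ⟨k, h1, h2, h3, h4⟩
        rw [blockSeq_eq_of h2 h1, if_pos h3, h4]
    rw [this]
    exact MeasurableSet.iUnion fun k => (Finset.measurableSet_biInter _ fun l _ =>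
      (hc l (measurableSet_singleton n)).compl).inter ((hc k (measurableSet_singleton n)).inter
      ((hc _ (measurableSet_singleton n)).inter (hx _ (measurableSet_singleton a))))
  cases o with
  | some a => exact key a
  | none =>
    have : (fun x : ℕ → D.Loc i => blockSeq (D.toShared i) n x j) ⁻¹' {none} =
        (⋃ a, {x : ℕ → D.Loc i | blockSeq (D.toShared i) n x j = some a})ᶜ := by
      ext x
      simp [Option.eq_none_iff_forall_ne_some]
    rw [this]
    exact (MeasurableSet.iUnion key).compl

theorem measurable_sigma (i : Fin 2) (n : ℕ) : Measurable (D.sigma i n) :=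
  (measurable_blockSeq i n).comp (D.measurable_component i)

theorem measurable_appendSeq {i : Fin 2} (l : List (D.Loc i)) :
    Measurable fun x : ℕ → D.Loc i => appendSeq l x := by
  refine measurable_pi_lambda _ fun k => ?_
  by_cases h : k < l.length
  · simp only [appendSeq_of_lt _ _ h]
    exact measurable_const
  · obtain ⟨j, rfl⟩ := Nat.exists_eq_add_of_le (not_lt.1 h)
    simp only [appendSeq_add_length]
    exact measurable_pi_apply j

theorem cyl_eq_range_concat (s : D.FinTraj) : D.cyl s = Set.range (D.concat s) := by
  ext ω
  constructor
  · intro h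
    have happ : ∀ i, appendSeq (s.1 i) (fun k => ω.1 i ((s.1 i).length + k)) = ω.1 i := by
      intro i
      funext k
      by_cases hk : k < (s.1 i).length
      · rw [appendSeq_of_lt _ _ hk, h i k hk]
      · obtain ⟨j, rfl⟩ := Nat.exists_eq_add_of_le (not_lt.1 hk)
        rw [appendSeq_add_length]
    refine ⟨⟨fun i k => ω.1 i ((s.1 i).length + k), ?_⟩, Subtype.ext (funext happ)⟩
    funext n
    have h2 := ω.2
    rw [← happ 0, ← happ 1, inducedSeq_appendSeq, inducedSeq_appendSeq, s.2] at h2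
    -- The two prefixes have the same `Q`-sequence, so comparing beyond its length shows that the
    -- tails also synchronize.
    simpa using congrFun h2 (((s.1 1).filterMap (D.toShared 1)).length + n)
  · rintro ⟨ω, rfl⟩ i k hk
    exact appendSeq_of_lt _ _ hk

theorem measurableSet_cyl (s : D.FinTraj) : MeasurableSet (D.cyl s) := by
  rw [cyl_eq_range_concat]
  exact (D.measurableEmbedding_concat s).measurableSet_range

/-- The local trajectory that ends with its unique visit to a shared state, in state `q`. -/
def PrivateWord.toList {i : Fin 2} (w : D.PrivateWord i) (q : D.Shared) : List (D.Loc i) :=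
  w.1 ++ [D.ofShared i q]

/-- The finite block of letters of `w.toList q`, continued by `none`. -/
def PrivateWord.block {i : Fin 2} (w : D.PrivateWord i) (q : D.Shared) (j : ℕ) :
    Option (D.Loc i) := (w.toList q)[j]?

theorem PrivateWord.block_injective {i : Fin 2} (q : D.Shared) :
    Function.Injective fun w : D.PrivateWord i => w.block q := fun _ _ h =>
  Subtype.ext (List.append_cancel_right (List.ext_getElem? fun j => congrFun h j))

/-- The elementary trajectory with given private parts and synchronization state `q`. -/
def elemTraj (q : D.Shared) (w : ∀ i, D.PrivateWord i) : D.FinTraj :=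
  ⟨fun i => (w i).toList q,
    (filterMap_eq_singleton (w 0).2 (D.toShared_ofShared 0 q)).trans
      (filterMap_eq_singleton (w 1).2 (D.toShared_ofShared 1 q)).symm⟩

section Concat

variable (q : D.Shared) (w : ∀ i, D.PrivateWord i) (ω : D.Traj)

theorem sigma_zero_concat (i : Fin 2) :
    D.sigma i 0 (D.concat (elemTraj q w) ω) = (w i).block q :=
  blockSeq_zero_appendSeq (w i).2 (D.toShared_ofShared i q) (ω.1 i)

theorem sigma_succ_concat (i : Fin 2) (n : ℕ) :
    D.sigma i (n + 1) (D.concat (elemTraj q w) ω) = D.sigma i n ω :=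
  blockSeq_succ_appendSeq (w i).2 (D.toShared_ofShared i q) n (ω.1 i)

theorem syncSeq_zero_concat : D.syncSeq (D.concat (elemTraj q w) ω) 0 = some q :=
  inducedSeq_zero_appendSeq (w 0).2 (D.toShared_ofShared 0 q) (ω.1 0)

theorem syncSeq_succ_concat (n : ℕ) :
    D.syncSeq (D.concat (elemTraj q w) ω) (n + 1) = D.syncSeq ω n :=
  inducedSeq_succ_appendSeq (w 0).2 (D.toShared_ofShared 0 q) (ω.1 0) n

theorem syncSeq_concat : D.syncSeq (D.concat (elemTraj q w) ω) =
    fun n => n.casesOn (some q) (D.syncSeq ω) := by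
  funext n
  cases n with
  | zero => exact syncSeq_zero_concat q w ω
  | succ n => exact syncSeq_succ_concat q w ω n

end Concat

theorem iUnion_cyl_elemTraj (q : D.Shared) :
    ⋃ w, D.cyl (elemTraj q w) = {ω : D.Traj | D.syncSeq ω 0 = some q} := by
  ext ω
  rw [Set.mem_iUnion]
  constructor
  · rintro ⟨w, hw⟩
    rw [cyl_eq_range_concat] at hw
    obtain ⟨ω, rfl⟩ := hw
    exact syncSeq_zero_concat q w ω
  · intro h
    have h' : ∀ i, ∃ (w : D.PrivateWord i) (y : ℕ → D.Loc i),
        ω.1 i = appendSeq (w.toList q) y := fun i => by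
      obtain ⟨l, b, y, hl, hb, hx⟩ := exists_appendSeq_of_inducedSeq_zero
        ((congrFun (inducedSeq_component i ω) 0).trans h)
      exact ⟨⟨l, hl⟩, y, by rw [hx, D.eq_ofShared hb]; rfl⟩
    choose w y hw using h'
    refine ⟨w, fun i k hk => ?_⟩
    rw [hw i, appendSeq_of_lt]
    rfl

/-- This expresses the weights of cylinders in terms of the first blocks and `Y_0`, the variables of
`FirstStepIndep`. -/
theorem cyl_elemTraj (q : D.Shared) (w : ∀ i, D.PrivateWord i) :
    D.cyl (elemTraj q w) = D.sigma 0 0 ⁻¹' {(w 0).block q} ∩ D.sigma 1 0 ⁻¹' {(w 1).block q} ∩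
      {ω : D.Traj | D.syncSeq ω 0 = some q} := by
  ext ω
  constructor
  · intro h
    rw [cyl_eq_range_concat] at h
    obtain ⟨ω, rfl⟩ := h
    exact ⟨⟨sigma_zero_concat q w ω 0, sigma_zero_concat q w ω 1⟩, syncSeq_zero_concat q w ω⟩
  · rintro ⟨⟨h0, h1⟩, h⟩
    rw [← iUnion_cyl_elemTraj, Set.mem_iUnion] at h
    obtain ⟨w', hw'⟩ := h
    have hw := hw'
    rw [cyl_eq_range_concat] at hw
    obtain ⟨ω, rfl⟩ := hw
    have : w' = w := by
      funext i
      refine PrivateWord.block_injective q ?_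
      simp only [← sigma_zero_concat q w' ω]
      fin_cases i
      · exact h0
      · exact h1
    rw [← this]
    exact hw'

theorem pairwise_disjoint_cyl_elemTraj (q : D.Shared) :
    Pairwise (Function.onFun Disjoint fun w => D.cyl (elemTraj q w)) := fun w w' hne => by
  refine Set.disjoint_left.2 fun ω h h' => hne ?_
  simp only [cyl_elemTraj] at h h'
  funext i
  refine PrivateWord.block_injective q ?_
  fin_cases i
  · exact h.1.1.symm.trans h'.1.1
  · exact h.1.2.symm.trans h'.1.2

/-- Both words end with `q`, so the initial state and the private parts are forgotten. -/
theorem gamma_elemTraj (α : D.GlobalState) (q : D.Shared) (w : ∀ i, D.PrivateWord i) :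
    D.gamma α (elemTraj q w) = D.diag q := by
  funext i
  simp [gamma, elemTraj, PrivateWord.toList, diag]

section NoSync

variable {ω : D.Traj}

theorem sigma_zero_of_syncSeq (h : D.syncSeq ω 0 = none) (i : Fin 2) (j : ℕ) :
    D.sigma i 0 ω j = some (ω.1 i j) :=
  blockSeq_zero_of_inducedSeq_zero ((congrFun (inducedSeq_component i ω) 0).trans h) j

theorem sigma_succ_of_syncSeq {n : ℕ} (h : D.syncSeq ω n = none) (i : Fin 2) :
    D.sigma i (n + 1) ω = fun _ => none := funext fun j =>
  blockSeq_succ_of_inducedSeq_eq_none ((congrFun (inducedSeq_component i ω) n).trans h) j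

theorem syncSeq_of_zero (h : D.syncSeq ω 0 = none) : D.syncSeq ω = fun _ => none :=
  funext fun n => inducedSeq_eq_none_of_zero h n

end NoSync

theorem measurable_syncSeq_apply (n : ℕ) : Measurable fun ω : D.Traj => D.syncSeq ω n :=
  (measurable_pi_apply n).comp D.measurable_syncSeq

theorem measurableSet_syncSeq_eq (n : ℕ) (o : Option D.Shared) :
    MeasurableSet {ω : D.Traj | D.syncSeq ω n = o} :=
  measurable_syncSeq_apply n (measurableSet_singleton o)

/-! ### The Markov property at the first synchronization. -/

namespace TwoCompFamily

variable (F : D.TwoCompFamily)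

open Classical in
/-- The law of the process started from the global state `(q, q)`, or `0` if this is not a
possible initial state. -/
def next (q : D.Shared) : Measure D.Traj :=
  if h : D.diag q ∈ F.X₀ then F.P ⟨_, h⟩ else 0

variable {F}

theorem next_eq (q : D.Shared) : F.next q = 0 ∨ ∃ α, F.next q = F.P α := by
  by_cases h : D.diag q ∈ F.X₀
  · exact .inr ⟨⟨_, h⟩, dif_pos h⟩
  · exact .inl (dif_neg h)

theorem restrict_cyl (hM : F.IsMarkov) (α : F.X₀) (s : D.FinTraj) (h : 0 < F.P α (D.cyl s)) :
    (F.P α).restrict (D.cyl s) = F.P α (D.cyl s) •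
      (F.P ⟨D.gamma α s, F.mem_of_reachable α _ ⟨s, h, rfl⟩⟩).map (D.concat s) := by
  rw [← hM α s h, future, (D.measurableEmbedding_concat s).map_comap, ← cyl_eq_range_concat,
    ProbabilityTheory.cond, Measure.restrict_smul, Measure.restrict_restrict (measurableSet_cyl s),
    Set.inter_self, smul_smul, ENNReal.mul_inv_cancel h.ne' (measure_ne_top _ _), one_smul]

/-- Multiplying out the conditioning makes the Markov property valid for null cylinders too. The law
`F.next q` does not depend on `w`. -/
theorem restrict_cyl_elemTraj (hM : F.IsMarkov) (α : F.X₀) (q : D.Shared)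
    (w : ∀ i, D.PrivateWord i) :
    (F.P α).restrict (D.cyl (elemTraj q w)) = F.P α (D.cyl (elemTraj q w)) •
      (F.next q).map (D.concat (elemTraj q w)) := by
  rcases eq_zero_or_pos (F.P α (D.cyl (elemTraj q w))) with h | h
  · rw [h, zero_smul, Measure.restrict_eq_zero.2 h]
  · have hmem := F.mem_of_reachable α _ ⟨elemTraj q w, h, rfl⟩
    rw [restrict_cyl hM α _ h]
    simp only [gamma_elemTraj] at hmem ⊢
    rw [next, dif_pos hmem]

theorem restrict_syncSeq_zero (hM : F.IsMarkov) (α : F.X₀) (q : D.Shared) :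
    (F.P α).restrict {ω | D.syncSeq ω 0 = some q} = Measure.sum fun w =>
      F.P α (D.cyl (elemTraj q w)) • (F.next q).map (D.concat (elemTraj q w)) := by
  rw [← iUnion_cyl_elemTraj, Measure.restrict_iUnion (pairwise_disjoint_cyl_elemTraj q)
    fun w => measurableSet_cyl _]
  simp only [restrict_cyl_elemTraj hM]

theorem setLIntegral_syncSeq_zero (hM : F.IsMarkov) (α : F.X₀) (q : D.Shared)
    {f : D.Traj → ℝ≥0∞} (hf : Measurable f) :
    ∫⁻ ω in {ω | D.syncSeq ω 0 = some q}, f ω ∂F.P α = ∑' w, F.P α (D.cyl (elemTraj q w)) *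
      ∫⁻ ω, f (D.concat (elemTraj q w) ω) ∂F.next q := by
  rw [restrict_syncSeq_zero hM, lintegral_sum_measure]
  refine tsum_congr fun w => ?_
  rw [lintegral_smul_measure, lintegral_map hf (D.measurableEmbedding_concat _).measurable,
    smul_eq_mul]

theorem measure_inter_syncSeq_zero (hM : F.IsMarkov) (α : F.X₀) (q : D.Shared)
    {W : Set D.Traj} (hW : MeasurableSet W) :
    F.P α (W ∩ {ω | D.syncSeq ω 0 = some q}) = ∑' w, F.P α (D.cyl (elemTraj q w)) *
      F.next q (D.concat (elemTraj q w) ⁻¹' W) := by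
  rw [← Measure.restrict_apply hW, restrict_syncSeq_zero hM, Measure.sum_apply _ hW]
  refine tsum_congr fun w => ?_
  rw [Measure.smul_apply, Measure.map_apply (D.measurableEmbedding_concat _).measurable hW,
    smul_eq_mul]

/-- `F.next q` has mass `1` unless `(q, q)` is outside `X₀`, in which case the cylinder is null. -/
theorem measure_cyl_mul_next_univ (hM : F.IsMarkov) (α : F.X₀) (q : D.Shared)
    (w : ∀ i, D.PrivateWord i) :
    F.P α (D.cyl (elemTraj q w)) * F.next q Set.univ = F.P α (D.cyl (elemTraj q w)) := by
  have h := congrArg (fun μ => μ Set.univ) (restrict_cyl_elemTraj hM α q w)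
  rw [Measure.restrict_apply_univ, Measure.smul_apply,
    Measure.map_apply (D.measurableEmbedding_concat _).measurable MeasurableSet.univ,
    Set.preimage_univ, smul_eq_mul] at h
  exact h.symm

/-! ### Independence of the components of the elementary trajectories -/

/-- The conditional independence of `σ¹_0` and `σ²_0` given `Y_0`, expressed by explicit
conditional probabilities. -/
def FirstStepIndep (μ : Measure D.Traj) : Prop :=
  ∀ B, MeasurableSet B → ∃ h : Option D.Shared → ℝ≥0∞, ∀ A, MeasurableSet A → ∀ z,
    μ (D.sigma 0 0 ⁻¹' A ∩ D.sigma 1 0 ⁻¹' B ∩ {ω | D.syncSeq ω 0 = z}) =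
      h z * μ (D.sigma 0 0 ⁻¹' A ∩ {ω | D.syncSeq ω 0 = z})

theorem firstStepIndep_next (hI : ∀ α, FirstStepIndep (F.P α)) (q : D.Shared) :
    FirstStepIndep (F.next q) := by
  rcases F.next_eq q with h | ⟨α, h⟩
  · exact fun B _ => ⟨0, fun A _ z => by simp [h]⟩
  · rw [h]
    exact hI α

theorem firstStepIndep_of_condIndepFun {μ : Measure D.Traj} [IsFiniteMeasure μ]
    (h : CondIndepFun (MeasurableSpace.comap (D.syncPair 0) inferInstance)
      (D.measurable_syncPair 0).comap_le (D.sigma 0 0) (D.sigma 1 0) μ) :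
    FirstStepIndep μ := by
  intro B hB
  obtain ⟨v, -, hv⟩ := exists_lintegral_of_condIndepFun (measurable_sigma 0 0)
    (measurable_sigma 1 0) (D.measurable_syncPair 0) h hB
  refine ⟨fun z => v (none, z), fun A hA z => ?_⟩
  have hz : D.syncPair 0 ⁻¹' {(none, z)} = {ω | D.syncSeq ω 0 = z} := by
    ext ω
    simp [syncPair, prevSync]
  have := hv A {(none, z)} hA (measurableSet_singleton _)
  rw [hz] at this
  rw [this, setLIntegral_congr_fun (g := fun _ => v (none, z))
    ((measurable_sigma 0 0 hA).inter (measurableSet_syncSeq_eq 0 z)), setLIntegral_const]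
  rintro ω ⟨-, hω⟩
  rw [← hz] at hω
  exact congrArg v hω

theorem condIndepFun_sigma_of_forall {μ : Measure D.Traj} [IsFiniteMeasure μ] {n : ℕ}
    (h : ∀ B, MeasurableSet B → ∃ v : Option D.Shared × Option D.Shared → ℝ≥0∞,
      ∀ A, MeasurableSet A → ∀ z,
        μ (D.sigma 0 n ⁻¹' A ∩ D.sigma 1 n ⁻¹' B ∩ D.syncPair n ⁻¹' {z}) =
          v z * μ (D.sigma 0 n ⁻¹' A ∩ D.syncPair n ⁻¹' {z})) :
    CondIndepFun (MeasurableSpace.comap (D.syncPair n) inferInstance)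
      (D.measurable_syncPair n).comap_le (D.sigma 0 n) (D.sigma 1 n) μ := by
  refine condIndepFun_of_exists_lintegral (measurable_sigma 0 n) (measurable_sigma 1 n)
    (D.measurable_syncPair n) MeasurableSpace.isPiSystem_measurableSet
    MeasurableSpace.generateFrom_measurableSet.symm fun B hB => ?_
  obtain ⟨v, hv⟩ := h B hB
  exact ⟨v, measurable_of_countable v, fun A C hA hC =>
    measure_inter_inter_eq_lintegral (measurable_sigma 0 n hA) (measurable_sigma 1 n hB)
      (D.measurable_syncPair n) (hv A hA) hC⟩

/-- By the Markov property, the conditional probabilities of the first step under `P_(q,q)` are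
also those of the step number `n + 1` given `Y_n = q`. -/
theorem measure_sigma_succ (hM : F.IsMarkov) {q : D.Shared} {A : Set (ℕ → Option (D.Loc 0))}
    {B : Set (ℕ → Option (D.Loc 1))} (hA : MeasurableSet A) (hB : MeasurableSet B)
    {z : Option D.Shared} {c : ℝ≥0∞}
    (h : F.next q (D.sigma 0 0 ⁻¹' A ∩ D.sigma 1 0 ⁻¹' B ∩ {ω | D.syncSeq ω 0 = z}) =
      c * F.next q (D.sigma 0 0 ⁻¹' A ∩ {ω | D.syncSeq ω 0 = z})) (n : ℕ) (α : F.X₀) :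
    F.P α (D.sigma 0 (n + 1) ⁻¹' A ∩ D.sigma 1 (n + 1) ⁻¹' B ∩
        ({ω | D.syncSeq ω n = some q} ∩ {ω | D.syncSeq ω (n + 1) = z})) =
      c * F.P α (D.sigma 0 (n + 1) ⁻¹' A ∩
        ({ω | D.syncSeq ω n = some q} ∩ {ω | D.syncSeq ω (n + 1) = z})) := by
  have hAm := fun n => measurable_sigma 0 n hA
  have hBm := fun n => measurable_sigma 1 n hB
  have hY := fun n => measurableSet_syncSeq_eq (D := D) n
  -- The statement is needed for all initial states, because the process restarts from `(q', q')`
  -- after its first synchronization.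
  induction n generalizing α with
  | zero =>
    rw [Set.inter_comm {ω : D.Traj | D.syncSeq ω 0 = some q}, ← Set.inter_assoc,
      ← Set.inter_assoc, measure_inter_syncSeq_zero hM α q
        (((hAm _).inter (hBm _)).inter (hY _ _)),
      measure_inter_syncSeq_zero hM α q ((hAm _).inter (hY _ _)), ← ENNReal.tsum_mul_left]
    refine tsum_congr fun w => ?_
    simp only [Set.preimage_inter, ← Set.preimage_comp, Set.preimage_ofPred_eq,
      Function.comp_def, sigma_succ_concat, syncSeq_succ_concat]
    rw [mul_left_comm]
    exact congrArg _ h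
  | succ n ih =>
    have hnext : ∀ q', F.next q' (D.sigma 0 (n + 1) ⁻¹' A ∩ D.sigma 1 (n + 1) ⁻¹' B ∩
        ({ω | D.syncSeq ω n = some q} ∩ {ω | D.syncSeq ω (n + 1) = z})) =
      c * F.next q' (D.sigma 0 (n + 1) ⁻¹' A ∩
        ({ω | D.syncSeq ω n = some q} ∩ {ω | D.syncSeq ω (n + 1) = z})) := fun q' => by
      rcases F.next_eq q' with h' | ⟨β, h'⟩
      · simp [h']
      · rw [h']
        exact ih β
    have hE := ((hAm (n + 2)).inter (hBm (n + 2))).inter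
      ((hY (n + 1) (some q)).inter (hY (n + 2) z))
    have hG := (hAm (n + 2)).inter ((hY (n + 1) (some q)).inter (hY (n + 2) z))
    -- Written as the integral of a constant, the right side can be compared on each fiber of `Y_0`.
    -- The fiber `Y_0 = *` is incompatible with `Y_{n+1} = q`.
    rw [← setLIntegral_const]
    refine measure_eq_setLIntegral_of_fiber (measurable_syncSeq_apply 0) hE hG fun o => ?_
    rw [setLIntegral_const]
    cases o with
    | none =>
      have hempty : ∀ E : Set D.Traj, E ∩ ({ω | D.syncSeq ω (n + 1) = some q} ∩
          {ω | D.syncSeq ω (n + 2) = z}) ∩ (fun ω => D.syncSeq ω 0) ⁻¹' {none} = ∅ := by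
        intro E
        refine Set.eq_empty_of_forall_notMem ?_
        rintro ω ⟨⟨-, h1, -⟩, h0⟩
        have h1' : D.syncSeq ω (n + 1) = some q := h1
        rw [syncSeq_of_zero h0] at h1'
        cases h1'
      rw [hempty, hempty]
      simp
    | some q' =>
      have hq' : (fun ω : D.Traj => D.syncSeq ω 0) ⁻¹' {some q'} =
        {ω | D.syncSeq ω 0 = some q'} := rfl
      rw [hq', measure_inter_syncSeq_zero hM α q' hE, measure_inter_syncSeq_zero hM α q' hG,
        ← ENNReal.tsum_mul_left]
      refine tsum_congr fun w => ?_
      simp only [Set.preimage_inter, ← Set.preimage_comp, Set.preimage_ofPred_eq,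
        Function.comp_def, sigma_succ_concat, syncSeq_succ_concat]
      rw [mul_left_comm]
      exact congrArg _ (hnext q')

theorem condIndepFun_sigma_of_firstStepIndep (hM : F.IsMarkov)
    (hI : ∀ α, FirstStepIndep (F.P α)) (n : ℕ) (α : F.X₀) :
    CondIndepFun (MeasurableSpace.comap (D.syncPair n) inferInstance)
      (D.measurable_syncPair n).comap_le (D.sigma 0 n) (D.sigma 1 n) (F.P α) := by
  classical
  refine condIndepFun_sigma_of_forall fun B hB => ?_
  cases n with
  | zero =>
    obtain ⟨h, hh⟩ := hI α B hB
    refine ⟨fun z => h z.2, fun A hA ⟨o, z⟩ => ?_⟩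
    cases o with
    | none =>
      have hz : D.syncPair 0 ⁻¹' {(none, z)} = {ω | D.syncSeq ω 0 = z} := by
        ext ω
        simp [syncPair, prevSync]
      rw [hz]
      exact hh A hA z
    | some q =>
      have hz : D.syncPair 0 ⁻¹' {(some q, z)} = ∅ := by
        ext ω
        simp [syncPair, prevSync]
      simp [hz]
  | succ n =>
    choose h hh using fun q => firstStepIndep_next hI q B hB
    -- If `Y_n = *`, then `σ²_{n+1}` is the constant sequence `none`, so its conditional probability
    -- of lying in `B` is `0` or `1`.
    refine ⟨fun z => z.1.elim (if (fun _ => none) ∈ B then 1 else 0) fun q => h q z.2,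
      fun A hA ⟨o, z⟩ => ?_⟩
    have hz : D.syncPair (n + 1) ⁻¹' {(o, z)} =
        {ω | D.syncSeq ω n = o} ∩ {ω | D.syncSeq ω (n + 1) = z} := by
      ext ω
      simp [syncPair, prevSync]
    rw [hz]
    cases o with
    | some q => exact measure_sigma_succ hM hA hB (hh q A hA z) n α
    | none =>
      have hs : ∀ ω ∈ {ω | D.syncSeq ω n = none} ∩ {ω | D.syncSeq ω (n + 1) = z},
          D.sigma 1 (n + 1) ω = fun _ => none := fun ω hω => sigma_succ_of_syncSeq hω.1 1
      by_cases hB0 : (fun _ => none) ∈ B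
      · simp only [Option.elim_none, hB0, if_true, one_mul]
        congr 1
        ext ω
        constructor
        · exact fun hω => ⟨hω.1.1, hω.2⟩
        · exact fun hω => ⟨⟨hω.1, by rw [Set.mem_preimage, hs ω hω.2]; exact hB0⟩, hω.2⟩
      · simp only [Option.elim_none, hB0, if_false, zero_mul]
        refine measure_mono_null ?_ measure_empty
        rintro ω ⟨⟨-, hω⟩, hω'⟩
        rw [Set.mem_preimage, hs ω hω'] at hω
        exact hB0 hω

/-- Given `Y_0 = q`, the later synchronizations are independent of `σ¹_0`, so `v(Y)` can be averaged
over them without changing its integral over events of `σ¹_0`. -/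
theorem firstStepIndep_of_localIndependence (hM : F.IsMarkov) (hL : F.LocalIndependence)
    (α : F.X₀) : FirstStepIndep (F.P α) := by
  classical
  intro B hB
  obtain ⟨v, hv, hvE⟩ := exists_lintegral_of_condIndepFun (D.measurable_component 0)
    (D.measurable_component 1) D.measurable_syncSeq (hL α) (measurable_blockSeq 1 0 hB)
  refine ⟨fun z => z.elim (v fun _ => none)
    fun q => ∫⁻ ω, v (fun n => n.casesOn (some q) (D.syncSeq ω)) ∂F.next q, fun A hA z => ?_⟩
  have hAm := measurable_sigma (D := D) 0 0 hA
  have hvY : Measurable fun ω : D.Traj => v (D.syncSeq ω) := hv.comp D.measurable_syncSeq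
  refine (hvE _ {y | y 0 = z} (measurable_blockSeq 0 0 hA)
    (measurable_pi_apply (X := fun _ : ℕ => Option D.Shared) 0 (measurableSet_singleton z))).trans ?_
  change ∫⁻ ω in D.sigma 0 0 ⁻¹' A ∩ {ω | D.syncSeq ω 0 = z}, v (D.syncSeq ω) ∂F.P α = _
  cases z with
  | none =>
    rw [setLIntegral_congr_fun (g := fun _ => v fun _ => none)
      (hAm.inter (measurableSet_syncSeq_eq 0 none)), setLIntegral_const]
    · rfl
    · rintro ω ⟨-, hω⟩
      exact congrArg v (syncSeq_of_zero hω)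
  | some q =>
    rw [← setLIntegral_indicator hAm, setLIntegral_syncSeq_zero hM α q
      (hvY.indicator hAm), measure_inter_syncSeq_zero hM α q hAm,
      ← ENNReal.tsum_mul_left]
    refine tsum_congr fun w => ?_
    -- On the cylinder of `w` the first block is fixed, so the event holds everywhere or nowhere.
    by_cases hw : (w 0).block q ∈ A
    · have hpre : D.concat (elemTraj q w) ⁻¹' (D.sigma 0 0 ⁻¹' A) = Set.univ :=
        Set.eq_univ_of_forall fun ω => by
          rw [Set.mem_preimage, Set.mem_preimage, sigma_zero_concat]
          exact hw
      rw [hpre, measure_cyl_mul_next_univ hM, mul_comm]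
      congr 1
      refine lintegral_congr fun ω => ?_
      rw [Set.indicator_of_mem (Set.mem_preimage.1 (hpre ▸ Set.mem_univ ω)), syncSeq_concat]
    · have hpre : ∀ ω, D.concat (elemTraj q w) ω ∉ D.sigma 0 0 ⁻¹' A := fun ω h => by
        rw [Set.mem_preimage, sigma_zero_concat] at h
        exact hw h
      have hpre' : D.concat (elemTraj q w) ⁻¹' (D.sigma 0 0 ⁻¹' A) = ∅ :=
        Set.eq_empty_of_forall_notMem hpre
      simp only [Set.indicator_of_notMem (hpre _), hpre', lintegral_zero, measure_empty, mul_zero]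

end TwoCompFamily

/-- When nothing synchronizes, the first block is the whole component; `L` recovers it measurably,
so that `FirstStepIndep` applies to events of the components. The letter `a` only fills the entries
`none`. -/
theorem exists_measurable_letters (D : DistributedSystem S) (i : Fin 2) :
    ∃ L : (ℕ → Option (D.Loc i)) → ℕ → D.Loc i, Measurable L ∧
      ∀ ω : D.Traj, D.syncSeq ω 0 = none → L (D.sigma i 0 ω) = ω.1 i := by
  obtain ⟨a⟩ : Nonempty (D.Loc i) := let ⟨a, ha, _⟩ := D.exists_private i; ⟨⟨a, ha⟩⟩
  refine ⟨fun b j => (b j).getD a, measurable_pi_lambda _ fun j =>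
    (measurable_of_countable fun o : Option (D.Loc i) => o.getD a).comp
      (measurable_pi_apply j), fun ω hω => funext fun j => ?_⟩
  exact congrArg (fun o : Option (D.Loc i) => o.getD a) (sigma_zero_of_syncSeq hω i j)

namespace TwoCompFamily

variable {F : D.TwoCompFamily}

/-! ### Independence of the two components given the synchronizations -/

/-- The conditional probability of `ω² ∈ V` given `ω¹` is a function of the sequence `Y`. -/
def CondProbOfSync (μ : Measure D.Traj) (V : Set (ℕ → D.Loc 1)) : Prop :=
  ∃ v : (ℕ → Option D.Shared) → ℝ≥0∞, Measurable v ∧ ∀ U, MeasurableSet U →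
    μ ((fun ω => ω.1 0) ⁻¹' U ∩ (fun ω => ω.1 1) ⁻¹' V) =
      ∫⁻ ω in (fun ω => ω.1 0) ⁻¹' U, v (D.syncSeq ω) ∂μ

theorem localIndependence_of_condProbOfSync
    (h : ∀ α, ∀ V ∈ measurableCylinders fun _ : ℕ => D.Loc 1, CondProbOfSync (F.P α) V) :
    F.LocalIndependence := fun α => by
  refine condIndepFun_of_exists_lintegral (D.measurable_component 0) (D.measurable_component 1)
    D.measurable_syncSeq isPiSystem_measurableCylinders generateFrom_measurableCylinders.symm
    fun V hV => ?_
  obtain ⟨v, hv, hvE⟩ := h α V hV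
  refine ⟨v, hv, fun A C hA hC => ?_⟩
  -- Since `Y` is a function of `ω¹`, the event `Y ∈ C` is absorbed into the event of `ω¹`.
  have := hvE (A ∩ inducedSeq (D.toShared 0) ⁻¹' C) (hA.inter (D.measurable_inducedSeq 0 hC))
  rw [Set.preimage_inter, Set.inter_right_comm] at this
  exact this

/-- If the first step decouples, then the joint weights of the elementary trajectories ending in
`q` are products of the weights of their first component by conditional probabilities. -/
theorem tsum_measure_cyl_mul (hM : F.IsMarkov) (α : F.X₀) (q : D.Shared)
    {κ : D.PrivateWord 1 → ℝ≥0∞}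
    (hκ : ∀ A, MeasurableSet A → ∀ w₁ : D.PrivateWord 1,
      F.P α (D.sigma 0 0 ⁻¹' A ∩ D.sigma 1 0 ⁻¹' {w₁.block q} ∩ {ω | D.syncSeq ω 0 = some q}) =
        κ w₁ * F.P α (D.sigma 0 0 ⁻¹' A ∩ {ω | D.syncSeq ω 0 = some q}))
    (I : D.PrivateWord 0 → D.PrivateWord 1 → ℝ≥0∞) :
    ∑' w, F.P α (D.cyl (elemTraj q w)) * I (w 0) (w 1) =
      ∑' w, F.P α (D.cyl (elemTraj q w)) * ∑' w₁, κ w₁ * I (w 0) w₁ := by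
  set e : (∀ i, D.PrivateWord i) ≃ D.PrivateWord 0 × D.PrivateWord 1 :=
    piFinTwoEquiv fun i => D.PrivateWord i with he
  have split : ∀ f : (∀ i, D.PrivateWord i) → ℝ≥0∞, ∑' w, f w =
      ∑' w₀, ∑' w₁, f (e.symm (w₀, w₁)) := fun f => by
    rw [← e.symm.tsum_eq, ENNReal.tsum_prod']
  have e0 : ∀ w₀ w₁, e.symm (w₀, w₁) 0 = w₀ := fun _ _ => rfl
  have e1 : ∀ w₀ w₁, e.symm (w₀, w₁) 1 = w₁ := fun _ _ => rfl
  -- Summing the joint weights over the second word gives the marginal weight of the first.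
  have hfst : ∀ w₀ : D.PrivateWord 0, ∑' w₁, F.P α (D.cyl (elemTraj q (e.symm (w₀, w₁)))) =
      F.P α (D.sigma 0 0 ⁻¹' {w₀.block q} ∩ {ω | D.syncSeq ω 0 = some q}) := fun w₀ => by
    classical
    rw [measure_inter_syncSeq_zero hM α q (measurable_sigma 0 0 (measurableSet_singleton _)),
      split, tsum_eq_single w₀]
    · refine tsum_congr fun w₁ => ?_
      have : D.concat (elemTraj q (e.symm (w₀, w₁))) ⁻¹' (D.sigma 0 0 ⁻¹' {w₀.block q}) =
          Set.univ := Set.eq_univ_of_forall fun ω => sigma_zero_concat q (e.symm (w₀, w₁)) ω 0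
      rw [this, measure_cyl_mul_next_univ hM]
    · intro w hw
      refine ENNReal.tsum_eq_zero.2 fun w₁ => ?_
      have : D.concat (elemTraj q (e.symm (w, w₁))) ⁻¹' (D.sigma 0 0 ⁻¹' {w₀.block q}) = ∅ := by
        refine Set.eq_empty_of_forall_notMem fun ω h => hw ?_
        rw [Set.mem_preimage, Set.mem_preimage, sigma_zero_concat] at h
        exact PrivateWord.block_injective q h
      rw [this, measure_empty, mul_zero]
  rw [split, split]
  refine tsum_congr fun w₀ => ?_
  simp only [e0, e1]
  rw [ENNReal.tsum_mul_right, hfst, ← ENNReal.tsum_mul_left]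
  refine tsum_congr fun w₁ => ?_
  rw [cyl_elemTraj, e0, e1, hκ _ (measurableSet_singleton _)]
  ring

theorem condProbOfSync_of_forall_lt (hM : F.IsMarkov) (hI : ∀ α, FirstStepIndep (F.P α)) (k : ℕ) :
    ∀ V, MeasurableSet V → (∀ x y : ℕ → D.Loc 1, (∀ j < k, x j = y j) → (x ∈ V → y ∈ V)) →
      ∀ α, CondProbOfSync (F.P α) V := by
  induction k with
  | zero =>
    intro V _ hV α
    -- A set that depends on no letter is empty or everything.
    rcases V.eq_empty_or_nonempty with rfl | ⟨x, hx⟩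
    · exact ⟨0, measurable_const, fun U _ => by simp⟩
    · have : V = Set.univ := Set.eq_univ_of_forall fun y => hV x y (by simp) hx
      exact ⟨1, measurable_const, fun U _ => by simp [this]⟩
  | succ k ih =>
    intro V hVm hV α
    have hnext : ∀ (q : D.Shared) (w₁ : D.PrivateWord 1),
        CondProbOfSync (F.next q) ((fun x => appendSeq (w₁.toList q) x) ⁻¹' V) := fun q w₁ => by
      rcases F.next_eq q with h | ⟨β, h⟩
      · exact ⟨0, measurable_const, fun U _ => by simp [h]⟩
      · rw [h]
        refine ih _ (measurable_appendSeq _ hVm) (fun x y hxy => hV _ _ fun j hj => ?_) β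
        by_cases hj' : j < (w₁.toList q).length
        · exact (appendSeq_of_lt _ _ hj').trans (appendSeq_of_lt _ _ hj').symm
        · obtain ⟨i, rfl⟩ := Nat.exists_eq_add_of_le (not_lt.1 hj')
          refine (appendSeq_add_length _ x i).trans (.trans (hxy i ?_)
            (appendSeq_add_length _ y i).symm)
          -- The removed word contains at least its final letter `q`, so at most `k` of the `k + 1`
          -- letters remain.
          simp only [PrivateWord.toList, List.length_append, List.length_singleton] at hj
          omega
    choose u hu huE using hnext
    choose κ hκ using fun (q : D.Shared) (w₁ : D.PrivateWord 1) =>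
      hI α {w₁.block q} (measurableSet_singleton _)
    obtain ⟨L₀, hL₀, hL₀'⟩ := D.exists_measurable_letters 0
    obtain ⟨L₁, hL₁, hL₁'⟩ := D.exists_measurable_letters 1
    obtain ⟨h, hh⟩ := hI α (L₁ ⁻¹' V) (hL₁ hVm)
    have hV1 := D.measurable_component 1 hVm
    -- Decomposition over the first block of `ω²`: `κ` is its conditional probability given `q`, and
    -- `u` is the conditional probability for the rest, a function of the shifted `Y`.
    let v : (ℕ → Option D.Shared) → ℝ≥0∞ := fun y => (y 0).elim (h none) fun q =>
      ∑' w₁, κ q w₁ (some q) * u q w₁ fun n => y (n + 1)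
    have hv : Measurable v := by
      have hF : Measurable fun p : (ℕ → Option D.Shared) × Option D.Shared =>
          p.2.elim (h none) fun q => ∑' w₁, κ q w₁ (some q) * u q w₁ fun n => p.1 (n + 1) := by
        refine measurable_from_prod_countable_left fun o => ?_
        cases o with
        | none => exact measurable_const
        | some q =>
          exact Measurable.tsum fun w₁ => ((hu q w₁).comp
            (measurable_pi_lambda _ fun n => measurable_pi_apply (n + 1))).const_mul _
      exact hF.comp (measurable_id.prodMk (measurable_pi_apply 0))
    have hvY : Measurable fun ω : D.Traj => v (D.syncSeq ω) := hv.comp D.measurable_syncSeq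
    refine ⟨v, hv, fun U hU => ?_⟩
    have hU0 := D.measurable_component 0 hU
    refine measure_eq_setLIntegral_of_fiber (measurable_syncSeq_apply 0) (hU0.inter hV1) hU0
      fun o => ?_
    change F.P α (_ ∩ {ω | D.syncSeq ω 0 = o}) = ∫⁻ ω in _ ∩ {ω | D.syncSeq ω 0 = o}, _ ∂F.P α
    cases o with
    | none =>
      rw [setLIntegral_congr_fun (g := fun _ => h none)
        (hU0.inter (measurableSet_syncSeq_eq 0 none)), setLIntegral_const]
      · refine Eq.trans (congrArg _ ?_) ((hh (L₀ ⁻¹' U) (hL₀ hU) none).trans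
          (congrArg (fun s => h none * F.P α s) ?_))
        · ext ω
          refine and_congr_left fun hω => ?_
          simp only [Set.mem_inter_iff, Set.mem_preimage, hL₀' ω hω, hL₁' ω hω]
        · ext ω
          refine and_congr_left fun hω => ?_
          simp only [Set.mem_preimage, hL₀' ω hω]
      · rintro ω ⟨-, hω⟩
        have hω' : D.syncSeq ω 0 = none := hω
        simp only [v, hω', Option.elim_none]
    | some q =>
      rw [← setLIntegral_indicator hU0, setLIntegral_syncSeq_zero hM α q (hvY.indicator hU0),
        measure_inter_syncSeq_zero hM α q (hU0.inter hV1)]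
      have hUw : ∀ w₀ : D.PrivateWord 0, MeasurableSet ((fun ω : D.Traj => ω.1 0) ⁻¹'
          ((fun x => appendSeq (w₀.toList q) x) ⁻¹' U)) := fun w₀ =>
        D.measurable_component 0 (measurable_appendSeq _ hU)
      have huY : ∀ w₁, Measurable fun ω : D.Traj => u q w₁ (D.syncSeq ω) := fun w₁ =>
        (hu q w₁).comp D.measurable_syncSeq
      -- The induction hypothesis rewrites each cylinder term as an integral of `u`; decoupling the
      -- first step then replaces the actual second word by its `κ`-average.
      refine (tsum_congr fun w => congrArg _ ?_).trans ((tsum_measure_cyl_mul hM α q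
        (κ := fun w₁ => κ q w₁ (some q)) (fun A hA w₁ => hκ q w₁ A hA (some q))
        fun w₀ w₁ => ∫⁻ ω in (fun ω : D.Traj => ω.1 0) ⁻¹'
          ((fun x => appendSeq (w₀.toList q) x) ⁻¹' U), u q w₁ (D.syncSeq ω) ∂F.next q).trans
        (tsum_congr fun w => congrArg _ ?_))
      · exact huE q (w 1) _ (measurable_appendSeq _ hU)
      · simp only [← lintegral_const_mul _ (huY _)]
        rw [← lintegral_tsum fun w₁ => ((huY w₁).const_mul _).aemeasurable,
          ← lintegral_indicator (hUw _)]
        refine lintegral_congr fun ω => ?_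
        simp only [Set.indicator, v, syncSeq_concat]
        rfl

theorem localIndependence_of_firstStepIndep (hM : F.IsMarkov)
    (hI : ∀ α, FirstStepIndep (F.P α)) : F.LocalIndependence := by
  refine localIndependence_of_condProbOfSync fun α V hV => ?_
  obtain ⟨s, T, -, rfl⟩ := (mem_measurableCylinders V).1 hV
  -- A cylinder set with coordinates in `s` depends only on the letters up to the largest index in
  -- `s`.
  refine condProbOfSync_of_forall_lt hM hI (s.sup id + 1) _ (.of_mem_measurableCylinders hV)
    (fun x y hxy hx => ?_) α
  rw [mem_cylinder] at hx ⊢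
  convert hx using 1
  funext j
  exact (hxy j (Nat.lt_succ_of_le (Finset.le_sup (f := id) j.2))).symm

end TwoCompFamily

end DistributedSystem

end

theorem mainTheorem4 {S : Type*} (D : DistributedSystem S) (F : D.TwoCompFamily) (hM : F.IsMarkov) :
    F.LocalIndependence ↔
      ∀ (n : ℕ) (α : F.X₀),
        CondIndepFun (MeasurableSpace.comap (D.syncPair n) inferInstance)
          (D.measurable_syncPair n).comap_le (D.sigma 0 n) (D.sigma 1 n) (F.P α) :=
  ⟨fun hL => DistributedSystem.TwoCompFamily.condIndepFun_sigma_of_firstStepIndep hM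
      (DistributedSystem.TwoCompFamily.firstStepIndep_of_localIndependence hM hL),
    fun h => DistributedSystem.TwoCompFamily.localIndependence_of_firstStepIndep hM fun α =>
      DistributedSystem.TwoCompFamily.firstStepIndep_of_condIndepFun (h 0 α)⟩
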